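/- Let $n\ge 2$. For $f\in L^2(\mathbb R^n)$ let $\hat f$ denote its unitary Fourier transform, $\hat f(\xi)=(2\pi)^{-n/2}\int_{\mathbb R^n} e^{-ix\cdot\xi}f(x)\,dx$ (extended to $L^2$ by Plancherel's theorem), and, whenever $\hat f$ is integrable, put $$e^{it\Delta}f(x)=(2\pi)^{-n/2}\int_{\mathbb R^n} e^{i(x\cdot\xi+t|\xi|^2)}\hat f(\xi)\,d\xi\qquad(x\in\mathbb R^n,\ t\in\mathbb R).$$ (i) For every real $s<\frac{n}{2(n+1)}$ there exist real numbers $R_k\to\infty$ and functions $f_k\in L^2(\mathbb R^n)$ $(k\in\mathbb N)$ with $\|f_k\|_{L^2}=1$ and $\hat f_k$ supported in the annulus $\{\xi: \tfrac12R_k\le|\xi|\le 2R_k\}$, such that $$\lim_{k\to\infty}R_k^{-s}\,\Big\|\sup_{0<t<1}\big|e^{it\Delta}f_k(x)\big|\Big\|_{L^1(B(0,1))}=\infty .$$ (ii) Consequently, control of the Schrödinger maximal function on $H^s(\mathbb R^n)$ requires $s\ge\frac n{2(n+1)}$: if $s\in\mathbb R$ and there is a finite constant $C$ such that $$\Big\|\sup_{0<t<1}\big|e^{it\Delta}f\big|\Big\|_{L^1(B(0,1))}\le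 C\,\|f\|_{H^s},\qquad \|f\|_{H^s}=\Big(\int_{\mathbb R^n}(1+|\xi|^2)^s|\hat f(\xi)|^2\,d\xi\Big)^{1/2},$$ for every Schwartz function $f$ on $\mathbb R^n$, then $s\ge\frac n{2(n+1)}$. -/

import Mathlib

open MeasureTheory Filter Topology
open scoped FourierTransform SchwartzMap ENNReal NNReal

noncomputable section

/-- `L²(ℝⁿ)`, complex valued, with the Euclidean norm and Lebesgue measure on `ℝⁿ`. -/
abbrev L2 (n : ℕ) : Type := Lp (α := EuclideanSpace ℝ (Fin n)) ℂ 2 volume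

/-- The unitary Fourier transform `f̂(ξ) = (2π)^{-n/2} ∫ e^{-i x·ξ} f(x) dx` of `f ∈ L²(ℝⁿ)`
(extended from Schwartz functions by Plancherel), obtained from Mathlib's `𝓕`, whose kernel is
`e^{-2πi x·ξ}`, by rescaling. It is defined up to almost everywhere equality. -/
def fourierHat {n : ℕ} (f : L2 n) (ξ : EuclideanSpace ℝ (Fin n)) : ℂ :=
  (((2 * Real.pi) ^ (-(n : ℝ) / 2) : ℝ) : ℂ) * (𝓕 f : L2 n) ((2 * Real.pi)⁻¹ • ξ)

/-- `e^{itΔ} f (x) = (2π)^{-n/2} ∫ e^{i (x·ξ + t|ξ|²)} f̂(ξ) dξ`, a pointwise defined function when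
`f̂` is integrable (in particular when `f̂` has bounded support, or when `f` is Schwartz). -/
def schrodinger {n : ℕ} (t : ℝ) (f : L2 n) (x : EuclideanSpace ℝ (Fin n)) : ℂ :=
  (((2 * Real.pi) ^ (-(n : ℝ) / 2) : ℝ) : ℂ) *
    ∫ ξ : EuclideanSpace ℝ (Fin n),
      Complex.exp (Complex.I * ((inner ℝ x ξ + t * ‖ξ‖ ^ 2 : ℝ) : ℂ)) * fourierHat f ξ

/-- The Schrödinger maximal function `sup_{0<t<1} |e^{itΔ} f (x)|`, with values in `[0, ∞]`. -/
def schrodingerMaximal {n : ℕ} (f : L2 n) (x : EuclideanSpace ℝ (Fin n)) : ℝ≥0∞ :=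
  ⨆ t ∈ Set.Ioo (0 : ℝ) 1, ‖schrodinger t f x‖ₑ

/-- The norm in `L¹(B(0, 1))` of the Schrödinger maximal function. -/
def maximalL1 {n : ℕ} (f : L2 n) : ℝ≥0∞ :=
  ∫⁻ x in Metric.ball (0 : EuclideanSpace ℝ (Fin n)) 1, schrodingerMaximal f x

/-- The Sobolev norm `‖f‖_{H^s} = (∫ (1 + |ξ|²)^s |f̂(ξ)|² dξ)^{1/2}`, with values in `[0, ∞]`. -/
def sobolevNorm {n : ℕ} (s : ℝ) (f : L2 n) : ℝ≥0∞ :=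
  (∫⁻ ξ : EuclideanSpace ℝ (Fin n),
    ENNReal.ofReal ((1 + ‖ξ‖ ^ 2) ^ s) * ‖fourierHat f ξ‖ₑ ^ 2) ^ (1 / 2 : ℝ)

/-- The Schrödinger maximal function is controlled on `H^s(ℝⁿ)`: there is a finite constant `C`
with `‖sup_{0<t<1} |e^{itΔ} f|‖_{L¹(B(0,1))} ≤ C ‖f‖_{H^s}` for every Schwartz function `f`. -/
def MaximalControlled (n : ℕ) (s : ℝ) : Prop :=
  ∃ C : ℝ≥0, ∀ f : 𝓢(EuclideanSpace ℝ (Fin n), ℂ),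
    maximalL1 (f.toLp 2 : L2 n) ≤ C * sobolevNorm s (f.toLp 2 : L2 n)

end

/-!
Write `n = d + 1` and let `f̂` be a normalised smooth bump adapted to an open set `U` of frequencies.
If for a given `x` there is a time `t ∈ (0, 1)` at which the phase `x·ξ + t|ξ|²` is, modulo `2π`,
within `1` of a constant on `U`, then nothing cancels in the integral defining `e^{itΔ} f (x)`, and
`|e^{itΔ} f (x)| ≳ |U|^{1/2}` (`exists_schwartz_le_maximalL1`). So it suffices to find, at frequency
scale `R`, a set `U` of measure `≳ R^{n/(n+1)}` which is in this sense coherent for all `x` in a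
fixed open subset of the unit ball.

The set is `frequencySet`, with `ρ = R^{1/2}`: the first coordinate ranges over an interval of
length `ρ` about `-R`, and the `j`-th of the other `d` coordinates over small neighbourhoods of an
arithmetic progression `θⱼ + D l`, `0 ≤ l < N`, with `R ≈ N^{2(d+2)}` and `D ≈ R / N`; its measure is
`≈ ρ N^d ≈ N^{2(d+1)} = R^{n/(n+1)}`. Coherence in the first coordinate forces
`t = x₀ / (2R) + O(R^{-3/2})`. At times `t = 2πm / D²` the quadratic phases `t D² l²` are multiples
of `2π`, so coherence in the `j`-th coordinate only asks that `xⱼ D + 2 t D θⱼ` lie within `O(1/N)`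
of `2πℤ`. With `θⱼ = D / (2 K^{j+1})`, where `K` is a constant multiple of `N`, this says that
`m / K^{j+1}` is within `O(1/K)` of a prescribed point modulo `1` for each `j`. The window for `t`
contains `K^d` consecutive integers `m`, and one of them works for any prescribed point: choose its
base-`K` digits one at a time (`exists_lt_pow_forall_abs_div_pow_add_sub_le`). Thus every `x` in the
slab has a good time (`exists_good_time`); no Gauss sums or equidistribution estimates are needed.

The data are Schwartz functions with Fourier transform in the annulus, where the `H^s` norm is
comparable to `R^s` times the `L²` norm (`sobolevNorm_le`). Hence the same functions contradict a
maximal estimate on `H^s` for any `s < n / (2(n+1))`.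
-/

/-! ### Schwartz functions with coherent frequencies -/

/-- A smooth bump adapted to a bounded open set, whose integral is at least any prescribed number
below the volume of the set. -/
theorem exists_contDiff_bump_of_isOpen {n : ℕ} {U : Set (EuclideanSpace ℝ (Fin n))}
    (hU : IsOpen U) (hb : Bornology.IsBounded U) {r : ℝ}
    (hr : ENNReal.ofReal r < volume U) :
    ∃ g : EuclideanSpace ℝ (Fin n) → ℝ, ContDiff ℝ (⊤ : ℕ∞) g ∧ HasCompactSupport g ∧
      (∀ ξ, 0 ≤ g ξ) ∧ (∀ ξ, g ξ ≤ 1) ∧ (∀ ξ, ξ ∉ U → g ξ = 0) ∧ r ≤ ∫ ξ, g ξ := by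
  obtain ⟨K, hKU, hK, hrK⟩ := hU.exists_lt_isCompact hr
  obtain ⟨g, hg, hrange, hsupp, hone⟩ := exists_contMDiff_support_eq_eq_one_iff
    (modelWithCornersSelf ℝ (EuclideanSpace ℝ (Fin n))) (n := (⊤ : ℕ∞)) hU hK.isClosed hKU
  have h01 : ∀ ξ, 0 ≤ g ξ ∧ g ξ ≤ 1 := fun ξ => hrange (Set.mem_range_self ξ)
  have hcs : HasCompactSupport g := by
    obtain ⟨ρ, hρ⟩ := hb.subset_closedBall 0
    exact HasCompactSupport.of_support_subset_isCompact
      (isCompact_closedBall 0 ρ) (hsupp ▸ hρ)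
  have hint : Integrable g := hg.contDiff.continuous.integrable_of_hasCompactSupport hcs
  refine ⟨g, hg.contDiff, hcs, fun ξ => (h01 ξ).1, fun ξ => (h01 ξ).2, fun ξ hξ => ?_, ?_⟩
  · rwa [← hsupp, Function.notMem_support] at hξ
  · have hfin : volume K ≠ ∞ := hK.measure_lt_top.ne
    calc r ≤ volume.real K := (ENNReal.ofReal_le_iff_le_toReal hfin).1 hrK.le
      _ = ∫ ξ in K, (1 : ℝ) := by simp
      _ = ∫ ξ in K, g ξ := setIntegral_congr_fun hK.measurableSet
          fun ξ hξ => ((hone ξ).1 hξ).symm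
      _ ≤ ∫ ξ, g ξ := setIntegral_le_integral hint (ae_of_all _ fun ξ => (h01 ξ).1)

/-- Every smooth compactly supported function is the unitary Fourier transform of a Schwartz
function, with equality of `L²` norms. -/
theorem exists_schwartz_fourierHat_eq {n : ℕ} {g : EuclideanSpace ℝ (Fin n) → ℂ}
    (hg : ContDiff ℝ (⊤ : ℕ∞) g) (hc : HasCompactSupport g) :
    ∃ f : 𝓢(EuclideanSpace ℝ (Fin n), ℂ),
      (∀ᵐ ξ, fourierHat (f.toLp 2 : L2 n) ξ = g ξ) ∧
      ‖(f.toLp 2 : L2 n)‖ = √(∫ ξ, ‖g ξ‖ ^ 2) := by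
  have hpi : (0 : ℝ) < 2 * Real.pi := by positivity
  set c : ℝ := (2 * Real.pi) ^ (-(n : ℝ) / 2) with hcdef
  have hc0 : 0 < c := by positivity
  have hc2 : (c⁻¹) ^ 2 = (2 * Real.pi) ^ n := by
    rw [← Real.rpow_natCast (2 * Real.pi) n, hcdef, ← Real.rpow_neg hpi.le, ← Real.rpow_natCast,
      ← Real.rpow_mul hpi.le]
    congr 1; push_cast; ring
  let L : EuclideanSpace ℝ (Fin n) ≃ₜ EuclideanSpace ℝ (Fin n) :=
    Homeomorph.smulOfNeZero (2 * Real.pi) hpi.ne'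
  have hsm : ContDiff ℝ (⊤ : ℕ∞) (fun η : EuclideanSpace ℝ (Fin n) =>
      ((c⁻¹ : ℝ) : ℂ) * g ((2 * Real.pi) • η)) :=
    contDiff_const.mul (hg.comp (contDiff_const_smul _))
  have hcs : HasCompactSupport (fun η : EuclideanSpace ℝ (Fin n) =>
      ((c⁻¹ : ℝ) : ℂ) * g ((2 * Real.pi) • η)) :=
    (hc.comp_homeomorph L).mul_left
  let h : 𝓢(EuclideanSpace ℝ (Fin n), ℂ) := hcs.toSchwartzMap hsm
  have hh : ∀ η, h η = ((c⁻¹ : ℝ) : ℂ) * g ((2 * Real.pi) • η) := fun η => rfl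
  refine ⟨𝓕⁻ h, ?_, ?_⟩
  · have h1 : 𝓕 ((𝓕⁻ h).toLp 2 : L2 n) = h.toLp 2 := by
      rw [SchwartzMap.toLp_fourier_eq, FourierTransform.fourier_fourierInv_eq]
    have h2 := (Measure.quasiMeasurePreserving_smul
      (volume : Measure (EuclideanSpace ℝ (Fin n))) (inv_ne_zero hpi.ne')).ae
      (h.coeFn_toLp 2 volume)
    filter_upwards [h2] with ξ hξ
    rw [fourierHat, h1, hξ, hh, smul_inv_smul₀ hpi.ne', ← mul_assoc, ← hcdef, ← Complex.ofReal_mul,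
      mul_inv_cancel₀ hc0.ne', Complex.ofReal_one, one_mul]
  · rw [← SchwartzMap.toLp_fourierInv_eq]
    have h1 : ‖(𝓕⁻ (h.toLp 2 : L2 n) : L2 n)‖ = ‖(h.toLp 2 : L2 n)‖ := by
      rw [← Lp.norm_fourier_eq, FourierTransform.fourier_fourierInv_eq]
    rw [h1, SchwartzMap.norm_toLp' (by simp) (by simp), Real.sqrt_eq_rpow]
    congr 1
    · simp only [ENNReal.toReal_ofNat, Real.rpow_ofNat, hh, norm_mul, Complex.norm_real, mul_pow,
        Real.norm_eq_abs, sq_abs]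
      rw [integral_const_mul, Measure.integral_comp_smul volume (fun η => ‖g η‖ ^ 2), hc2,
        finrank_euclideanSpace_fin, abs_of_pos (by positivity), smul_eq_mul,
        mul_inv_cancel_left₀ (by positivity)]
    · simp

/-- No cancellation occurs in `∫ e^{iΦ} g` for `g ≥ 0` when the phase `Φ` stays, modulo `2π`, within
`1` of a constant on the support of `g`, because `cos 1 ≥ 1/2`. -/
theorem half_integral_le_norm_integral_exp_mul {E : Type*} [TopologicalSpace E] [MeasurableSpace E]
    [OpensMeasurableSpace E] {μ : Measure E}
    {g Φ : E → ℝ} (hg : Integrable g μ) (hg0 : ∀ ξ, 0 ≤ g ξ)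
    (hΦ : Continuous Φ) {U : Set E} (hU : ∀ ξ, ξ ∉ U → g ξ = 0) {φ : ℝ}
    (hphase : ∀ ξ ∈ U, ∃ k : ℤ, |Φ ξ - φ - 2 * Real.pi * k| ≤ 1) :
    1 / 2 * ∫ ξ, g ξ ∂μ ≤ ‖∫ ξ, Complex.exp (Complex.I * (Φ ξ : ℂ)) * (g ξ : ℂ) ∂μ‖ := by
  have key : ∀ ξ, 1 / 2 * g ξ ≤
      (Complex.exp (Complex.I * ((Φ ξ - φ : ℝ) : ℂ)) * (g ξ : ℂ)).re := by
    intro ξ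
    have hre : (Complex.exp (Complex.I * ((Φ ξ - φ : ℝ) : ℂ)) * (g ξ : ℂ)).re
        = Real.cos (Φ ξ - φ) * g ξ := by
      rw [Complex.re_mul_ofReal, mul_comm Complex.I, Complex.exp_ofReal_mul_I_re]
    rw [hre]
    by_cases hξ : ξ ∈ U
    · obtain ⟨k, hk⟩ := hphase ξ hξ
      have hcos : Real.cos (Φ ξ - φ) = Real.cos (Φ ξ - φ - 2 * Real.pi * k) := by
        rw [show 2 * Real.pi * (k : ℝ) = k * (2 * Real.pi) by ring, Real.cos_sub_int_mul_two_pi]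
      have h1 := Real.one_sub_sq_div_two_le_cos (x := Φ ξ - φ - 2 * Real.pi * k)
      have h2 : (Φ ξ - φ - 2 * Real.pi * k) ^ 2 ≤ 1 := (sq_le_one_iff_abs_le_one _).2 hk
      rw [hcos]
      exact mul_le_mul_of_nonneg_right (by linarith) (hg0 ξ)
    · simp [hU ξ hξ]
  have hint : ∀ Ψ : E → ℝ, Continuous Ψ →
      Integrable (fun ξ => Complex.exp (Complex.I * (Ψ ξ : ℂ)) * (g ξ : ℂ)) μ := by
    intro Ψ hΨ
    refine hg.ofReal.bdd_mul (c := 1) ?_ (ae_of_all _ fun ξ => ?_)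
    · exact (Measurable.aestronglyMeasurable (by fun_prop))
    · rw [mul_comm, Complex.norm_exp_ofReal_mul_I]
  calc 1 / 2 * ∫ ξ, g ξ ∂μ = ∫ ξ, 1 / 2 * g ξ ∂μ := (integral_const_mul _ _).symm
    _ ≤ ∫ ξ, (Complex.exp (Complex.I * ((Φ ξ - φ : ℝ) : ℂ)) * (g ξ : ℂ)).re ∂μ :=
        integral_mono (hg.const_mul _) (hint _ (by fun_prop)).re key
    _ = (∫ ξ, Complex.exp (Complex.I * ((Φ ξ - φ : ℝ) : ℂ)) * (g ξ : ℂ) ∂μ).re :=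
        integral_re (hint _ (by fun_prop))
    _ ≤ ‖∫ ξ, Complex.exp (Complex.I * ((Φ ξ - φ : ℝ) : ℂ)) * (g ξ : ℂ) ∂μ‖ := Complex.re_le_norm _
    _ = ‖Complex.exp (((-φ : ℝ) : ℂ) * Complex.I) *
          ∫ ξ, Complex.exp (Complex.I * (Φ ξ : ℂ)) * (g ξ : ℂ) ∂μ‖ := by
        rw [← integral_const_mul]
        congr 2 with ξ
        rw [← mul_assoc, ← Complex.exp_add]
        congr 2
        push_cast
        ring
    _ = ‖∫ ξ, Complex.exp (Complex.I * (Φ ξ : ℂ)) * (g ξ : ℂ) ∂μ‖ := by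
        rw [norm_mul, Complex.norm_exp_ofReal_mul_I, one_mul]

/-- If `f̂` is a nonnegative multiple `a g` of a bump `g` on whose support the phase `x·ξ + t|ξ|²` is
nearly constant modulo `2π`, then `|e^{itΔ} f (x)|` is comparable to the trivial bound `a ∫ g`. -/
theorem le_norm_schrodinger {n : ℕ} {f : L2 n} {g : EuclideanSpace ℝ (Fin n) → ℝ} {a : ℝ}
    (ha : 0 ≤ a) (hf : ∀ᵐ ξ, fourierHat f ξ = ((a * g ξ : ℝ) : ℂ))
    (hg : Integrable g) (hg0 : ∀ ξ, 0 ≤ g ξ) {U : Set (EuclideanSpace ℝ (Fin n))}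
    (hgU : ∀ ξ, ξ ∉ U → g ξ = 0) {x : EuclideanSpace ℝ (Fin n)} {t φ : ℝ}
    (hφ : ∀ ξ ∈ U, ∃ k : ℤ, |inner ℝ x ξ + t * ‖ξ‖ ^ 2 - φ - 2 * Real.pi * k| ≤ 1) :
    (2 * Real.pi) ^ (-(n : ℝ) / 2) * (a * (1 / 2 * ∫ ξ, g ξ)) ≤ ‖schrodinger t f x‖ := by
  have hcong : ∫ ξ : EuclideanSpace ℝ (Fin n),
        Complex.exp (Complex.I * ((inner ℝ x ξ + t * ‖ξ‖ ^ 2 : ℝ) : ℂ)) * fourierHat f ξ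
      = (a : ℂ) * ∫ ξ : EuclideanSpace ℝ (Fin n), Complex.exp
        (Complex.I * ((inner ℝ x ξ + t * ‖ξ‖ ^ 2 : ℝ) : ℂ)) * (g ξ : ℂ) := by
    rw [← integral_const_mul]
    refine integral_congr_ae ?_
    filter_upwards [hf] with ξ hξ
    rw [hξ, Complex.ofReal_mul]
    ring
  have hosc := half_integral_le_norm_integral_exp_mul hg hg0
    (Φ := fun ξ => inner ℝ x ξ + t * ‖ξ‖ ^ 2) (by fun_prop) hgU hφ
  rw [schrodinger, hcong, norm_mul, norm_mul, Complex.norm_real, Complex.norm_real,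
    Real.norm_of_nonneg (by positivity), Real.norm_of_nonneg ha]
  gcongr

/-- The lower bound mechanism: if for every `x ∈ V` some time `t ∈ (0, 1)` makes the phase
`x·ξ + t|ξ|²` nearly constant modulo `2π` on `U`, then a normalised Schwartz function with Fourier
transform a smooth bump adapted to `U` has maximal function `≳ |U|^{1/2}` on `V`. -/
theorem exists_schwartz_le_maximalL1 {n : ℕ} {U V : Set (EuclideanSpace ℝ (Fin n))}
    (hU : IsOpen U) (hb : Bornology.IsBounded U) {r : ℝ} (hr0 : 0 < r)
    (hr : ENNReal.ofReal r < volume U) (hV : V ⊆ Metric.ball 0 1) (hVm : MeasurableSet V)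
    (hphase : ∀ x ∈ V, ∃ t ∈ Set.Ioo (0 : ℝ) 1, ∃ φ : ℝ, ∀ ξ ∈ U, ∃ k : ℤ,
      |inner ℝ x ξ + t * ‖ξ‖ ^ 2 - φ - 2 * Real.pi * k| ≤ 1) :
    ∃ f : 𝓢(EuclideanSpace ℝ (Fin n), ℂ), ‖(f.toLp 2 : L2 n)‖ = 1 ∧
      (∀ᵐ ξ, ξ ∉ U → fourierHat (f.toLp 2 : L2 n) ξ = 0) ∧
      ENNReal.ofReal ((2 * Real.pi) ^ (-(n : ℝ) / 2) * (1 / 2 * √r)) * volume V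
        ≤ maximalL1 (f.toLp 2 : L2 n) := by
  obtain ⟨g, hg, hgc, hg0, hg1, hgU, hgr⟩ := exists_contDiff_bump_of_isOpen hU hb hr
  have hgint : Integrable g := hg.continuous.integrable_of_hasCompactSupport hgc
  have hsqc : HasCompactSupport (fun ξ => g ξ ^ 2) := hgc.comp_left (g := fun y => y ^ 2) (by simp)
  have hg2int : Integrable (fun ξ => g ξ ^ 2) :=
    (hg.continuous.pow 2).integrable_of_hasCompactSupport hsqc
  set J := ∫ ξ, g ξ with hJ
  set I := ∫ ξ, g ξ ^ 2 with hI
  have hJ0 : 0 < J := hr0.trans_le hgr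
  have hIJ : I ≤ J := integral_mono hg2int hgint fun ξ => by
    have := hg0 ξ; have := hg1 ξ; dsimp only; nlinarith
  have hI0 : 0 < I := by
    refine (integral_nonneg fun ξ => sq_nonneg (g ξ)).lt_of_ne' fun h0 => hJ0.ne' ?_
    rw [integral_eq_zero_iff_of_nonneg (fun ξ => sq_nonneg (g ξ)) hg2int] at h0
    rw [hJ, integral_eq_zero_of_ae]
    filter_upwards [h0] with ξ hξ
    exact pow_eq_zero_iff (two_ne_zero) |>.1 hξ
  have hsI : 0 < √I := Real.sqrt_pos.2 hI0
  have hGc : HasCompactSupport (fun ξ => (((√I)⁻¹ * g ξ : ℝ) : ℂ)) :=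
    hgc.comp_left (g := fun y : ℝ => (((√I)⁻¹ * y : ℝ) : ℂ)) (by simp)
  have hG : ContDiff ℝ (⊤ : ℕ∞) (fun ξ => (((√I)⁻¹ * g ξ : ℝ) : ℂ)) :=
    Complex.ofRealCLM.contDiff.comp (contDiff_const.mul hg)
  obtain ⟨f, hf, hfn⟩ := exists_schwartz_fourierHat_eq hG hGc
  refine ⟨f, ?_, ?_, ?_⟩
  · rw [hfn]
    have : ∫ ξ, ‖(((√I)⁻¹ * g ξ : ℝ) : ℂ)‖ ^ 2 = 1 := by
      simp only [Complex.norm_real, Real.norm_eq_abs, sq_abs, mul_pow]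
      rw [integral_const_mul, ← hI, inv_pow, Real.sq_sqrt hI0.le, inv_mul_cancel₀ hI0.ne']
    rw [this, Real.sqrt_one]
  · filter_upwards [hf] with ξ hξ hξU
    rw [hξ, hgU ξ hξU]; simp
  · have key : ∀ x ∈ V, ENNReal.ofReal ((2 * Real.pi) ^ (-(n : ℝ) / 2) * (1 / 2 * √r)) ≤
        schrodingerMaximal (f.toLp 2 : L2 n) x := by
      intro x hx
      obtain ⟨t, ht, φ, hφ⟩ := hphase x hx
      rw [schrodingerMaximal]
      refine le_iSup₂_of_le t ht ?_
      rw [← ofReal_norm]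
      refine ENNReal.ofReal_le_ofReal ?_
      refine le_trans ?_ (le_norm_schrodinger (by positivity) hf hgint hg0 hgU hφ)
      refine mul_le_mul_of_nonneg_left ?_ (by positivity)
      calc 1 / 2 * √r ≤ 1 / 2 * √J := by gcongr
        _ = (√J)⁻¹ * (1 / 2 * J) := by
            have := Real.sqrt_pos.2 hJ0
            have h2 := Real.mul_self_sqrt hJ0.le
            field_simp
            linarith
        _ ≤ (√I)⁻¹ * (1 / 2 * J) := by gcongr
    rw [← setLIntegral_const, maximalL1]
    exact (setLIntegral_mono' hVm key).trans (lintegral_mono_set hV)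

/-! ### Digit expansions and multiples of a point on the torus -/

/-- Every point of the torus `(ℝ/ℤ)^d` is within `1/K` of one of the first `K^d` multiples of
`(K⁻¹, K⁻², …, K⁻ᵈ)`: the base-`K` digits of the multiple adjust the coordinates one by one. -/
theorem exists_lt_pow_forall_abs_div_pow_add_sub_le {K : ℕ} (hK : 0 < K) (d : ℕ) (y : ℕ → ℝ) :
    ∃ r < K ^ d, ∀ j < d, ∃ k : ℤ, |(r : ℝ) / (K : ℝ) ^ (j + 1) + y j - k| ≤ 1 / K := by
  have hK' : (0 : ℝ) < K := by exact_mod_cast hK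
  induction d with
  | zero => exact ⟨0, by simp, by simp⟩
  | succ d ih =>
    obtain ⟨r, hr, hrj⟩ := ih
    set z : ℝ := (r : ℝ) / (K : ℝ) ^ (d + 1) + y d with hz
    set c : ℤ := ⌈-z * K⌉ with hc
    have hKz : (0 : ℤ) < K := by exact_mod_cast hK
    obtain ⟨a, ha⟩ := Int.eq_ofNat_of_zero_le (Int.emod_nonneg c hKz.ne')
    have haK : a < K := by
      have := Int.emod_lt_of_pos c hKz
      rw [ha] at this
      exact_mod_cast this
    have hca : (c : ℝ) = a + K * (c / (K : ℤ) : ℤ) := by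
      have := Int.emod_add_mul_ediv c K
      rw [ha] at this
      exact_mod_cast this.symm
    refine ⟨r + a * K ^ d, ?_, fun j hj => ?_⟩
    · calc r + a * K ^ d < K ^ d + a * K ^ d := by gcongr
        _ = (a + 1) * K ^ d := by ring
        _ ≤ K * K ^ d := by gcongr; omega
        _ = K ^ (d + 1) := by ring
    · rcases Nat.lt_succ_iff_lt_or_eq.1 hj with hj | rfl
      · obtain ⟨k, hk⟩ := hrj j hj
        refine ⟨k + a * K ^ (d - (j + 1)), ?_⟩
        have hpow : (K : ℝ) ^ d = (K : ℝ) ^ (d - (j + 1)) * (K : ℝ) ^ (j + 1) := by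
          rw [← pow_add]; congr 1; omega
        convert hk using 2
        push_cast
        rw [hpow]
        field_simp
        ring
      · refine ⟨-(c / (K : ℤ)), ?_⟩
        have h1 : ((r + a * K ^ j : ℕ) : ℝ) / (K : ℝ) ^ (j + 1) + y j - ((-(c / (K : ℤ)) : ℤ) : ℝ)
            = (c - -z * K) / K := by
          rw [hca, hz]
          push_cast
          field_simp
          ring
        have h2 := Int.le_ceil (-z * K)
        have h3 := Int.ceil_lt_add_one (-z * K)
        rw [h1, abs_of_nonneg (div_nonneg (by linarith) hK'.le)]
        gcongr
        linarith

/-! ### The frequency set and its phases -/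

/-- The set of frequencies `ξ` with `ξ₀` within `ρ/2` of `-ρ²`, each remaining coordinate lying
within `δ` of the arithmetic progression `θⱼ, θⱼ + D, …, θⱼ + (N - 1) D`. -/
def frequencySet {d : ℕ} (ρ D δ : ℝ) (N : ℕ) (θ : Fin d → ℝ) :
    Set (EuclideanSpace ℝ (Fin (d + 1))) :=
  {ξ | |ξ 0 + ρ ^ 2| < ρ / 2 ∧ ∀ j : Fin d, ∃ l < N, |ξ j.succ - (D * l + θ j)| < δ}

section frequencySet

variable {d : ℕ} {ρ D δ : ℝ} {N : ℕ} {θ : Fin d → ℝ}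

theorem frequencySet_eq_preimage : frequencySet ρ D δ N θ =
    WithLp.ofLp ⁻¹' Set.univ.pi (Fin.cons (α := fun _ => Set ℝ) (Metric.ball (-ρ ^ 2) (ρ / 2))
      fun j => ⋃ l ∈ Finset.range N, Metric.ball (D * l + θ j) δ) := by
  ext ξ
  simp [frequencySet, Set.mem_pi, Fin.forall_fin_succ, Real.dist_eq]

theorem isOpen_frequencySet : IsOpen (frequencySet ρ D δ N θ) := by
  rw [frequencySet_eq_preimage]
  refine (isOpen_set_pi Set.finite_univ fun i _ => ?_).preimage (PiLp.continuous_ofLp _ _)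
  cases i using Fin.cases with
  | zero => exact Metric.isOpen_ball
  | succ j => exact isOpen_biUnion fun l _ => Metric.isOpen_ball

theorem volume_frequencySet (hρ : 0 ≤ ρ) (hδ : 0 ≤ δ) (hD : 2 * δ ≤ D) :
    volume (frequencySet ρ D δ N θ) = ENNReal.ofReal (ρ * (N * (2 * δ)) ^ d) := by
  have hslab : ∀ j : Fin d, volume (⋃ l ∈ Finset.range N, Metric.ball (D * l + θ j) δ)
      = ENNReal.ofReal (N * (2 * δ)) := by
    intro j
    rw [measure_biUnion_finset]
    · simp only [Real.volume_ball, Finset.sum_const, Finset.card_range, nsmul_eq_mul]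
      rw [ENNReal.ofReal_mul (Nat.cast_nonneg N), ENNReal.ofReal_natCast]
    · intro a _ b _ hab
      refine Metric.ball_disjoint_ball ?_
      rw [Real.dist_eq]
      have h1 : (1 : ℝ) ≤ |(a : ℝ) - b| := by
        have : (1 : ℤ) ≤ |(a : ℤ) - b| := Int.one_le_abs (sub_ne_zero.2 (by exact_mod_cast hab))
        exact_mod_cast this
      rw [show D * a + θ j - (D * b + θ j) = D * ((a : ℝ) - b) by ring, abs_mul,
        abs_of_nonneg (by linarith : 0 ≤ D)]
      nlinarith
    · exact fun l _ => measurableSet_ball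
  have hmeas : MeasurableSet (Set.univ.pi (Fin.cons (α := fun _ => Set ℝ)
      (Metric.ball (-ρ ^ 2) (ρ / 2)) fun j : Fin d => ⋃ l ∈ Finset.range N, Metric.ball (D * l + θ j) δ)) := by
    refine MeasurableSet.univ_pi fun i => ?_
    cases i using Fin.cases with
    | zero => exact measurableSet_ball
    | succ j => exact Finset.measurableSet_biUnion _ fun l _ => measurableSet_ball
  rw [frequencySet_eq_preimage,
    (PiLp.volume_preserving_ofLp (Fin (d + 1))).measure_preimage hmeas.nullMeasurableSet,
    volume_pi_pi, Fin.prod_univ_succ]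
  simp only [Fin.cons_zero, Fin.cons_succ, hslab, Finset.prod_const, Finset.card_univ,
    Fintype.card_fin, Real.volume_ball]
  rw [ENNReal.ofReal_mul hρ, ENNReal.ofReal_pow (by positivity)]
  congr 2
  ring

theorem norm_mem_of_mem_frequencySet (hd : 0 < d) (hρ : 1 ≤ ρ) (hD : 0 ≤ D)
    (hDN : D * N ≤ ρ ^ 2 / (4 * d)) (hθ0 : ∀ j, 0 ≤ θ j) (hθ : ∀ j, θ j ≤ ρ ^ 2 / (4 * d))
    (hδ : δ ≤ ρ ^ 2 / (4 * d)) {ξ : EuclideanSpace ℝ (Fin (d + 1))}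
    (hξ : ξ ∈ frequencySet ρ D δ N θ) : ρ ^ 2 / 2 ≤ ‖ξ‖ ∧ ‖ξ‖ ≤ 2 * ρ ^ 2 := by
  have hd1 : (1 : ℝ) ≤ d := by exact_mod_cast hd
  obtain ⟨h0, hj⟩ := hξ
  rw [abs_lt] at h0
  have hρ2 : ρ ≤ ρ ^ 2 := by nlinarith
  constructor
  · refine le_trans ?_ (PiLp.norm_apply_le ξ 0)
    rw [Real.norm_eq_abs]
    refine le_trans ?_ (neg_le_abs _)
    linarith
  · refine abs_le_of_sq_le_sq' ?_ (by positivity) |>.2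
    rw [EuclideanSpace.real_norm_sq_eq, Fin.sum_univ_succ]
    have hsum : ∑ j : Fin d, ξ j.succ ^ 2 ≤ ∑ _j : Fin d, (ρ ^ 2 / d) ^ 2 := by
      refine Finset.sum_le_sum fun j _ => sq_le_sq' ?_ ?_
      all_goals
        obtain ⟨l, hl, hlξ⟩ := hj j
        rw [abs_lt] at hlξ
        have hlN : D * l ≤ D * N := by gcongr
        have hl0 : 0 ≤ D * l := by positivity
        have := hθ j
        have := hθ0 j
        have h4 : ρ ^ 2 / d = 4 * (ρ ^ 2 / (4 * d)) := by field_simp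
        linarith
    have h0' : ξ 0 ^ 2 ≤ (3 / 2 * ρ ^ 2) ^ 2 := sq_le_sq' (by linarith) (by linarith)
    have hc : ∑ _j : Fin d, (ρ ^ 2 / d) ^ 2 ≤ (ρ ^ 2) ^ 2 := by
      rw [Finset.sum_const, Finset.card_univ, Fintype.card_fin, nsmul_eq_mul, div_pow,
        show (d : ℝ) * ((ρ ^ 2) ^ 2 / d ^ 2) = (ρ ^ 2) ^ 2 / d by field_simp]
      exact div_le_self (by positivity) hd1
    nlinarith

theorem abs_phase_first_coord_le {x t ξ : ℝ} (ht : 0 ≤ t)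
    (hx : |x - 2 * ρ ^ 2 * t| * (ρ / 2) ≤ 1 / 8) (htρ : ρ ^ 2 * t ≤ 1 / 2)
    (hξ : |ξ + ρ ^ 2| < ρ / 2) :
    |x * ξ + t * ξ ^ 2 - (-x * ρ ^ 2 + t * ρ ^ 4)| ≤ 1 / 4 := by
  set η := ξ + ρ ^ 2 with hη
  have hξη : x * ξ + t * ξ ^ 2 - (-x * ρ ^ 2 + t * ρ ^ 4) =
      (x - 2 * ρ ^ 2 * t) * η + t * η ^ 2 := by rw [hη]; ring
  rw [hξη]
  refine (abs_add_le _ _).trans ?_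
  have h1 : |(x - 2 * ρ ^ 2 * t) * η| ≤ 1 / 8 := by
    rw [abs_mul]
    exact (mul_le_mul_of_nonneg_left hξ.le (abs_nonneg _)).trans hx
  have h2 : |t * η ^ 2| ≤ 1 / 8 := by
    rw [abs_of_nonneg (by positivity)]
    have : η ^ 2 ≤ (ρ / 2) ^ 2 := sq_le_sq.2 (hξ.le.trans (le_abs_self _))
    nlinarith
  linarith

/-- At a time `t ∈ 2πD⁻²ℤ` the quadratic terms `t D² l²` are multiples of `2π`, so the phase is
nearly constant modulo `2π` along the progression `θ + D l` as soon as `x D + 2 t D θ` is close to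
`2πℤ`. -/
theorem abs_phase_progression_le {ε x t θ ξ : ℝ} {l : ℕ} {m k : ℤ} (hε : ε ≤ 1)
    (ht : 0 ≤ t) (ht1 : t ≤ 1) (hx : |x| ≤ 1) (hl : l ≤ N)
    (hm : t * D ^ 2 = 2 * Real.pi * m) (hθ : 0 ≤ θ) (hD : 0 ≤ D) (htD : 2 * t * (D * N + θ) ≤ 1)
    (hk : |x * D + 2 * t * D * θ - 2 * Real.pi * k| * N ≤ ε)
    (hξ : |ξ - (D * l + θ)| < ε / 4) :
    |x * ξ + t * ξ ^ 2 - (x * θ + t * θ ^ 2) - 2 * Real.pi * ((k * l + m * l ^ 2 : ℤ) : ℝ)|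
      ≤ 2 * ε := by
  set η := ξ - (D * l + θ) with hη
  have hexp : x * ξ + t * ξ ^ 2 - (x * θ + t * θ ^ 2) -
      2 * Real.pi * ((k * l + m * l ^ 2 : ℤ) : ℝ) =
      (x * D + 2 * t * D * θ - 2 * Real.pi * k) * l
        + (η * (x + 2 * t * (D * l + θ)) + t * η ^ 2) := by
    have : 2 * Real.pi * (m : ℝ) * l ^ 2 = t * D ^ 2 * l ^ 2 := by rw [hm]
    rw [hη]
    push_cast
    linear_combination -this
  have hl' : (l : ℝ) ≤ N := by exact_mod_cast hl
  have h1 : |(x * D + 2 * t * D * θ - 2 * Real.pi * k) * l| ≤ ε := by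
    rw [abs_mul, Nat.abs_cast]
    exact (mul_le_mul_of_nonneg_left hl' (abs_nonneg _)).trans hk
  have h2 : |x + 2 * t * (D * l + θ)| ≤ 2 := by
    refine (abs_add_le _ _).trans ?_
    have : D * l ≤ D * N := by gcongr
    rw [abs_of_nonneg (by positivity : 0 ≤ 2 * t * (D * l + θ))]
    have : 2 * t * (D * l + θ) ≤ 2 * t * (D * N + θ) := by gcongr
    linarith
  have h3 : |η * (x + 2 * t * (D * l + θ))| ≤ ε / 2 := by
    rw [abs_mul]
    nlinarith [abs_nonneg η, abs_nonneg (x + 2 * t * (D * l + θ))]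
  have h4 : |t * η ^ 2| ≤ ε / 4 := by
    rw [abs_of_nonneg (by positivity), ← sq_abs]
    have h5 : |η| ^ 2 ≤ ε / 4 := by nlinarith [abs_nonneg η]
    nlinarith [sq_nonneg |η|]
  rw [hexp]
  have h6 := abs_add_le ((x * D + 2 * t * D * θ - 2 * Real.pi * k) * l)
    (η * (x + 2 * t * (D * l + θ)) + t * η ^ 2)
  have h7 := abs_add_le (η * (x + 2 * t * (D * l + θ))) (t * η ^ 2)
  have h8 : 0 ≤ ε := by linarith [abs_nonneg η]
  linarith

/-- Summing the coordinatewise estimates: on `frequencySet` the phase `x·ξ + t|ξ|²` is within `1` of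
a constant modulo `2π`. -/
theorem exists_phase_const_on_frequencySet (hd : 0 < d)
    {x : EuclideanSpace ℝ (Fin (d + 1))} {t : ℝ} {m : ℤ} (ht : 0 ≤ t) (ht1 : t ≤ 1)
    (hx : ∀ i, |x i| ≤ 1) (hx0 : |x 0 - 2 * ρ ^ 2 * t| * (ρ / 2) ≤ 1 / 8)
    (htρ : ρ ^ 2 * t ≤ 1 / 2) (hm : t * D ^ 2 = 2 * Real.pi * m) (hD : 0 ≤ D)
    (hθ : ∀ j, 0 ≤ θ j) (htD : ∀ j, 2 * t * (D * N + θ j) ≤ 1)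
    (hk : ∀ j : Fin d, ∃ k : ℤ,
      |x j.succ * D + 2 * t * D * θ j - 2 * Real.pi * k| * N ≤ 1 / (8 * d))
    (hδ : δ ≤ 1 / (32 * d)) :
    ∃ φ : ℝ, ∀ ξ ∈ frequencySet ρ D δ N θ, ∃ k : ℤ,
      |inner ℝ x ξ + t * ‖ξ‖ ^ 2 - φ - 2 * Real.pi * k| ≤ 1 := by
  have hd1 : (1 : ℝ) ≤ d := by exact_mod_cast hd
  choose k hk using hk
  refine ⟨(-x 0 * ρ ^ 2 + t * ρ ^ 4) + ∑ j : Fin d, (x j.succ * θ j + t * θ j ^ 2), ?_⟩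
  rintro ξ ⟨h0, hj⟩
  choose l hlN hl using hj
  refine ⟨∑ j : Fin d, (k j * l j + m * l j ^ 2), ?_⟩
  have hsplit : inner ℝ x ξ + t * ‖ξ‖ ^ 2 -
      ((-x 0 * ρ ^ 2 + t * ρ ^ 4) + ∑ j : Fin d, (x j.succ * θ j + t * θ j ^ 2)) -
      2 * Real.pi * ((∑ j : Fin d, (k j * l j + m * l j ^ 2) : ℤ) : ℝ) =
      (x 0 * ξ 0 + t * ξ 0 ^ 2 - (-x 0 * ρ ^ 2 + t * ρ ^ 4)) +
      ∑ j : Fin d, (x j.succ * ξ j.succ + t * ξ j.succ ^ 2 - (x j.succ * θ j + t * θ j ^ 2) -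
        2 * Real.pi * ((k j * l j + m * l j ^ 2 : ℤ) : ℝ)) := by
    rw [EuclideanSpace.real_norm_sq_eq, PiLp.inner_apply, Fin.sum_univ_succ, Fin.sum_univ_succ,
      Int.cast_sum]
    simp only [RCLike.inner_apply, conj_trivial, Finset.sum_sub_distrib, Finset.sum_add_distrib,
      ← Finset.mul_sum]
    have : ∀ j : Fin d, ξ j.succ * x j.succ = x j.succ * ξ j.succ := fun j => mul_comm _ _
    simp only [this]
    ring
  rw [hsplit]
  have hε : 1 / (8 * (d : ℝ)) ≤ 1 := by
    rw [div_le_one (by positivity)]; linarith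
  have hsum : |∑ j : Fin d, (x j.succ * ξ j.succ + t * ξ j.succ ^ 2 -
      (x j.succ * θ j + t * θ j ^ 2) - 2 * Real.pi * ((k j * l j + m * l j ^ 2 : ℤ) : ℝ))|
      ≤ 1 / 4 := by
    refine (Finset.abs_sum_le_sum_abs _ _).trans ?_
    calc _ ≤ ∑ _j : Fin d, 2 * (1 / (8 * (d : ℝ))) := Finset.sum_le_sum fun j _ =>
          abs_phase_progression_le hε ht ht1 (hx _) (hlN j).le hm (hθ j) hD (htD j) (hk j)
            ((hl j).trans_le (hδ.trans_eq (by ring)))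
      _ = 1 / 4 := by
          rw [Finset.sum_const, Finset.card_univ, Fintype.card_fin, nsmul_eq_mul]
          field_simp
          norm_num
  have hfirst := abs_phase_first_coord_le ht hx0 htρ h0
  exact (abs_add_le _ _).trans (by linarith)

end frequencySet

/-! ### Times of coherence -/

/-- The slab `1/4 < x₀ < 1/2` of the unit ball. -/
def ballSlab (d : ℕ) : Set (EuclideanSpace ℝ (Fin (d + 1))) :=
  Metric.ball 0 1 ∩ {x | 1 / 4 < x 0 ∧ x 0 < 1 / 2}

theorem isOpen_ballSlab (d : ℕ) : IsOpen (ballSlab d) := by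
  have h : Continuous fun x : EuclideanSpace ℝ (Fin (d + 1)) => x 0 := by fun_prop
  exact Metric.isOpen_ball.inter (isOpen_Ioo.preimage h)

theorem volume_ballSlab_pos (d : ℕ) : 0 < volume (ballSlab d) := by
  refine (isOpen_ballSlab d).measure_pos _ ⟨EuclideanSpace.single 0 (3 / 8), ?_, ?_⟩
  · rw [mem_ball_zero_iff, PiLp.norm_single, Real.norm_eq_abs]
    norm_num
  · norm_num

/-- Every point of the slab admits a time satisfying all the conditions under which the phase is
nearly constant on `frequencySet`, provided `ρ` is large compared with `N^{d+2}`. -/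
theorem exists_good_time {d N K : ℕ} (hd : 0 < d) (hN : 0 < N) (hK : K = 64 * d * N) {ρ D : ℝ}
    (hρ1 : 1 ≤ ρ) (hρ : 1024 * d ^ 2 * (64 * d) ^ d * N ^ (d + 2) ≤ ρ)
    (hD : D = ρ ^ 2 / (4 * d * N)) {x : EuclideanSpace ℝ (Fin (d + 1))} (hx : x ∈ ballSlab d) :
    ∃ (t : ℝ) (m : ℤ), 0 < t ∧ ρ ^ 2 * t ≤ 1 / 2 ∧ |x 0 - 2 * ρ ^ 2 * t| * (ρ / 2) ≤ 1 / 8 ∧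
      t * D ^ 2 = 2 * Real.pi * m ∧
      ∀ j : Fin d, ∃ k : ℤ,
        |x j.succ * D + 2 * t * D * (D / (2 * (K : ℝ) ^ (j.val + 1))) - 2 * Real.pi * k| * N ≤
          1 / (8 * d) := by
  obtain ⟨-, hx0, hx0'⟩ := hx
  have hd1 : (1 : ℝ) ≤ d := by exact_mod_cast hd
  have hN1 : (1 : ℝ) ≤ N := by exact_mod_cast hN
  have hKnat : 0 < K := by rw [hK]; positivity
  have hKR : (K : ℝ) = 64 * d * N := by rw [hK]; push_cast; ring
  have hK0 : (0 : ℝ) < K := by exact_mod_cast hKnat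
  have hpi := Real.pi_pos
  have hpi4 := Real.pi_lt_four
  have hρ0 : 0 < ρ := by linarith
  have hD0 : 0 < D := by rw [hD]; positivity
  -- the length of the window of admissible times is short compared with `ρ⁻³`
  set w : ℝ := 2 * Real.pi * K ^ d / D ^ 2 with hw
  have hw8 : w * (8 * ρ ^ 3) ≤ 1 := by
    have h1 : 16 * Real.pi * K ^ d * ρ ^ 3 ≤ D ^ 2 := by
      have h2 : D ^ 2 = ρ ^ 3 * ρ / (16 * d ^ 2 * N ^ 2) := by rw [hD]; field_simp; norm_num
      rw [h2, le_div_iff₀ (by positivity)]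
      calc 16 * Real.pi * K ^ d * ρ ^ 3 * (16 * d ^ 2 * N ^ 2)
          = ρ ^ 3 * (256 * Real.pi * d ^ 2 * (64 * d) ^ d * N ^ (d + 2)) := by
            rw [hKR, mul_pow _ (N : ℝ), pow_add]; ring
        _ ≤ ρ ^ 3 * (256 * 4 * d ^ 2 * (64 * d) ^ d * N ^ (d + 2)) := by gcongr
        _ ≤ ρ ^ 3 * ρ := by gcongr; linarith
    rw [hw, div_mul_eq_mul_div, div_le_one (by positivity)]
    linarith
  have hw0 : 0 < w := by positivity
  -- `m₀` is the first integer whose time `2πm₀ / D²` is at least `x₀ / (2ρ²)`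
  set m₀ : ℕ := ⌈D ^ 2 * x 0 / (4 * Real.pi * ρ ^ 2)⌉₊ with hm₀
  have harg : 0 ≤ D ^ 2 * x 0 / (4 * Real.pi * ρ ^ 2) := by
    have : 0 < x 0 := by linarith
    positivity
  have hm1 := Nat.le_ceil (D ^ 2 * x 0 / (4 * Real.pi * ρ ^ 2))
  have hm2 := Nat.ceil_lt_add_one harg
  rw [← hm₀] at hm1 hm2
  obtain ⟨r, hr, hrj⟩ := exists_lt_pow_forall_abs_div_pow_add_sub_le hKnat d
    (fun j => (if h : j < d then x (Fin.succ ⟨j, h⟩) else 0) * D / (2 * Real.pi)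
      + m₀ / (K : ℝ) ^ (j + 1))
  have hr1 : (r : ℝ) + 1 ≤ K ^ d := by exact_mod_cast hr
  have hr0 : (0 : ℝ) ≤ r := Nat.cast_nonneg r
  set t : ℝ := 2 * Real.pi * (m₀ + r) / D ^ 2 with ht
  have ht1 : x 0 / (2 * ρ ^ 2) ≤ t := by
    have : x 0 / (2 * ρ ^ 2) = 2 * Real.pi * (D ^ 2 * x 0 / (4 * Real.pi * ρ ^ 2)) / D ^ 2 := by
      field_simp
      norm_num
    rw [this, ht]
    gcongr
    linarith
  have ht2 : t ≤ x 0 / (2 * ρ ^ 2) + w := by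
    have : x 0 / (2 * ρ ^ 2) + w =
        2 * Real.pi * (D ^ 2 * x 0 / (4 * Real.pi * ρ ^ 2) + K ^ d) / D ^ 2 := by
      rw [hw]
      field_simp
      ring
    rw [this, ht]
    gcongr ?_ / _
    gcongr 2 * Real.pi * ?_
    linarith
  have ht3 : x 0 ≤ 2 * ρ ^ 2 * t := by
    rw [div_le_iff₀ (by positivity)] at ht1
    linarith
  have ht4 : 2 * ρ ^ 2 * t ≤ x 0 + 2 * ρ ^ 2 * w := by
    have := mul_le_mul_of_nonneg_left ht2 (by positivity : 0 ≤ 2 * ρ ^ 2)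
    rwa [mul_add, mul_div_cancel₀ _ (by positivity)] at this
  have hwρ : 2 * ρ ^ 2 * w * ρ ≤ 1 / 4 := by nlinarith
  refine ⟨t, m₀ + r, ?_, ?_, ?_, ?_, fun j => ?_⟩
  · have : 0 < x 0 := by linarith
    exact lt_of_lt_of_le (by positivity) ht1
  · have : 2 * ρ ^ 2 * w ≤ 2 * ρ ^ 2 * w * ρ := le_mul_of_one_le_right (by positivity) hρ1
    linarith
  · rw [abs_of_nonpos (by linarith)]
    have : -(x 0 - 2 * ρ ^ 2 * t) * (ρ / 2) ≤ 2 * ρ ^ 2 * w * (ρ / 2) := by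
      gcongr
      linarith
    linarith
  · rw [ht]
    push_cast
    field_simp
  · obtain ⟨k, hk⟩ := hrj j j.isLt
    refine ⟨k, ?_⟩
    rw [dif_pos j.isLt] at hk
    have htD : t * D ^ 2 = 2 * Real.pi * (m₀ + r) := by rw [ht]; field_simp
    have heq : x j.succ * D + 2 * t * D * (D / (2 * (K : ℝ) ^ (j.val + 1))) - 2 * Real.pi * k
        = 2 * Real.pi * (r / (K : ℝ) ^ (j.val + 1) +
          (x j.succ * D / (2 * Real.pi) + m₀ / (K : ℝ) ^ (j.val + 1)) - k) := by
      have h1 : 2 * t * D * (D / (2 * (K : ℝ) ^ (j.val + 1))) = t * D ^ 2 / K ^ (j.val + 1) := by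
        field_simp
      rw [h1, htD]
      field_simp
      ring
    rw [heq, abs_mul, abs_of_pos (by positivity : 0 < 2 * Real.pi)]
    calc _ ≤ 2 * Real.pi * (1 / K) * N := by gcongr
      _ = 2 * Real.pi / (64 * d) := by rw [hKR]; field_simp
      _ ≤ 8 / (64 * d) := by gcongr; linarith
      _ = 1 / (8 * d) := by ring

/-- For `n = d + 1` and every `N`, at frequency scale `R = A² N^{2(d+2)}` there is a set of
frequencies of measure `≳ N^{2(d+1)} ≈ R^{n/(n+1)}` all of whose waves are in phase at a suitable
time in `(0, 1)`, for every point of the slab. -/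
theorem exists_coherent_frequencySet (d : ℕ) (hd : 0 < d) :
    ∃ A c : ℝ, 1 ≤ A ∧ 0 < c ∧ ∀ N : ℕ, 0 < N →
      ∃ U : Set (EuclideanSpace ℝ (Fin (d + 1))), IsOpen U ∧
        (∀ ξ ∈ U, (A * N ^ (d + 2)) ^ 2 / 2 ≤ ‖ξ‖ ∧ ‖ξ‖ ≤ 2 * (A * N ^ (d + 2)) ^ 2) ∧
        ENNReal.ofReal (c * N ^ (2 * (d + 1))) < volume U ∧
        ∀ x ∈ ballSlab d, ∃ t ∈ Set.Ioo (0 : ℝ) 1, ∃ φ : ℝ, ∀ ξ ∈ U, ∃ k : ℤ,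
          |inner ℝ x ξ + t * ‖ξ‖ ^ 2 - φ - 2 * Real.pi * k| ≤ 1 := by
  have hd1 : (1 : ℝ) ≤ d := by exact_mod_cast hd
  set A : ℝ := 1024 * d ^ 2 * (64 * d) ^ d with hA
  have hA1 : 1024 * (d : ℝ) ^ 2 ≤ A := by
    refine le_mul_of_one_le_right (by positivity) (one_le_pow₀ (by linarith))
  have hAd : 1024 * (d : ℝ) ≤ A := by nlinarith
  have hA0 : 0 < A := by linarith
  refine ⟨A, A * (1 / (16 * d)) ^ d / 2, by linarith, by positivity, fun N hN => ?_⟩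
  have hN1 : (1 : ℝ) ≤ N := by exact_mod_cast hN
  set ρ : ℝ := A * N ^ (d + 2) with hρ
  have hNpow : (N : ℝ) ≤ N ^ (d + 2) := le_self_pow₀ hN1 (by omega)
  have hρN : 1024 * (d : ℝ) * N ≤ ρ := by rw [hρ]; gcongr
  have hdN : 1 ≤ (d : ℝ) * N := one_le_mul_of_one_le_of_one_le hd1 hN1
  have hρ1 : 1 ≤ ρ := by nlinarith
  have hρsq : ρ ≤ ρ ^ 2 := le_self_pow₀ hρ1 two_ne_zero
  set D : ℝ := ρ ^ 2 / (4 * d * N) with hD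
  have hD1 : 1 ≤ D := by
    rw [hD, le_div_iff₀ (by positivity)]
    nlinarith
  have hDN : D * N = ρ ^ 2 / (4 * d) := by rw [hD]; field_simp
  have hDle : D ≤ ρ ^ 2 / (4 * d) := by rw [← hDN]; exact le_mul_of_one_le_right (by linarith) hN1
  set K : ℕ := 64 * d * N with hK
  have hK1 : (1 : ℝ) ≤ K := by
    have : 0 < K := by positivity
    exact_mod_cast this
  set θ : Fin d → ℝ := fun j => D / (2 * (K : ℝ) ^ (j.val + 1)) with hθ
  have hθ0 : ∀ j, 0 ≤ θ j := fun j => by positivity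
  have hθD : ∀ j, θ j ≤ D := fun j => by
    refine div_le_self (by linarith) ?_
    have := one_le_pow₀ hK1 (n := j.val + 1)
    linarith
  set δ : ℝ := 1 / (32 * d) with hδ
  have hδ1 : δ ≤ 1 / 32 := by
    rw [hδ]; gcongr; linarith
  refine ⟨frequencySet ρ D δ N θ, isOpen_frequencySet, fun ξ hξ => ?_, ?_, fun x hx => ?_⟩
  · exact norm_mem_of_mem_frequencySet hd hρ1 (by linarith) hDN.le hθ0
      (fun j => (hθD j).trans hDle) (by linarith) hξ
  · rw [volume_frequencySet (by linarith) (by positivity) (by linarith)]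
    have heq : ρ * (N * (2 * δ)) ^ d = 2 * (A * (1 / (16 * d)) ^ d / 2 * N ^ (2 * (d + 1))) := by
      rw [hρ, hδ, show (N : ℝ) * (2 * (1 / (32 * d))) = N * (1 / (16 * d)) by field_simp; norm_num,
        mul_pow, show 2 * (d + 1) = (d + 2) + d by ring, pow_add (N : ℝ) (d + 2) d]
      ring
    rw [heq]
    have hpos : 0 < A * (1 / (16 * (d : ℝ))) ^ d / 2 * N ^ (2 * (d + 1)) := by positivity
    exact (ENNReal.ofReal_lt_ofReal_iff (by linarith)).2 (by linarith)
  · obtain ⟨t, m, ht0, htρ, hx0, hm, hk⟩ := exists_good_time hd hN hK hρ1 (by rw [hρ, hA]) hD hx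
    have ht1 : t < 1 := by nlinarith
    refine ⟨t, ⟨ht0, ht1⟩, exists_phase_const_on_frequencySet hd ht0.le ht1.le (fun i => ?_) hx0 htρ
      hm (by linarith) hθ0 (fun j => ?_) hk hδ.le⟩
    · exact (PiLp.norm_apply_le x i).trans (mem_ball_zero_iff.1 hx.1).le
    · have h1 : D * N + θ j ≤ ρ ^ 2 := by
        have h2 : ρ ^ 2 / (4 * d) ≤ ρ ^ 2 / 4 := by gcongr; linarith
        have := hθD j
        have := sq_nonneg ρ
        linarith
      have := mul_le_mul_of_nonneg_left h1 (by linarith : 0 ≤ 2 * t)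
      linarith

/-! ### Sobolev norms and the asymptotic lower bound -/

/-- Plancherel's theorem for the unitary normalisation of the Fourier transform. -/
theorem lintegral_enorm_fourierHat_sq {n : ℕ} (f : L2 n) :
    ∫⁻ ξ, ‖fourierHat f ξ‖ₑ ^ 2 = ‖f‖ₑ ^ 2 := by
  have hpi : (0 : ℝ) < 2 * Real.pi := by positivity
  have hscale : ∀ F : EuclideanSpace ℝ (Fin n) → ℝ≥0∞,
      ∫⁻ ξ, F ((2 * Real.pi)⁻¹ • ξ) = ENNReal.ofReal ((2 * Real.pi) ^ n) * ∫⁻ ξ, F ξ := by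
    intro F
    have h := lintegral_map_equiv (μ := (volume : Measure (EuclideanSpace ℝ (Fin n)))) F
      (Homeomorph.smulOfNeZero ((2 * Real.pi)⁻¹) (inv_ne_zero hpi.ne')).toMeasurableEquiv
    have h2 := Measure.map_addHaar_smul (volume : Measure (EuclideanSpace ℝ (Fin n)))
      (inv_ne_zero hpi.ne')
    rw [finrank_euclideanSpace_fin, inv_pow, inv_inv, abs_of_pos (by positivity)] at h2
    have h3 := congrArg (fun μ : Measure (EuclideanSpace ℝ (Fin n)) => ∫⁻ ξ, F ξ ∂μ) h2
    simp only [lintegral_smul_measure, smul_eq_mul] at h3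
    rw [← h3]
    exact h.symm
  have hc : ‖(((2 * Real.pi) ^ (-(n : ℝ) / 2) : ℝ) : ℂ)‖ₑ ^ 2 *
      ENNReal.ofReal ((2 * Real.pi) ^ n) = 1 := by
    rw [← ofReal_norm, Complex.norm_real, Real.norm_of_nonneg (by positivity),
      ← ENNReal.ofReal_pow (by positivity), ← ENNReal.ofReal_mul (by positivity),
      ← Real.rpow_natCast (2 * Real.pi) n, ← Real.rpow_natCast, ← Real.rpow_mul hpi.le,
      ← Real.rpow_add hpi]
    norm_num
  have hnorm : ∫⁻ ξ, ‖(𝓕 f : L2 n) ξ‖ₑ ^ 2 = ‖f‖ₑ ^ 2 := by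
    have h1 : ‖(𝓕 f : L2 n)‖ₑ = ‖f‖ₑ := by
      rw [← ofReal_norm, ← ofReal_norm, Lp.norm_fourier_eq]
    rw [← h1, Lp.enorm_def]
    have := eLpNorm_nnreal_pow_eq_lintegral (p := 2) (f := (𝓕 f : L2 n)) (μ := volume) two_ne_zero
    simpa using this.symm
  simp only [fourierHat, enorm_mul, mul_pow]
  rw [lintegral_const_mul' _ _ (by simp), hscale (fun η => ‖(𝓕 f : L2 n) η‖ₑ ^ 2), ← mul_assoc, hc,
    one_mul, hnorm]

/-- On an annulus of radius `R` the Sobolev weight is comparable to `R^{2s}`; the constant covers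
both signs of `s`. -/
theorem sobolevNorm_le {n : ℕ} {f : L2 n} {R : ℝ} (hR : 1 ≤ R) (s : ℝ)
    (hf : ∀ᵐ ξ, ¬ (R / 2 ≤ ‖ξ‖ ∧ ‖ξ‖ ≤ 2 * R) → fourierHat f ξ = 0) :
    sobolevNorm s f ≤ ENNReal.ofReal (√((1 / 4) ^ s + 5 ^ s) * R ^ s) * ‖f‖ₑ := by
  have hR0 : 0 < R := by linarith
  have hweight : ∀ y : ℝ, R / 2 ≤ y → y ≤ 2 * R →
      (1 + y ^ 2) ^ s ≤ ((1 / 4) ^ s + 5 ^ s) * (R ^ s) ^ 2 := by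
    intro y h1 h2
    have hR2 : (R ^ s) ^ 2 = (R ^ 2) ^ s := by
      rw [← Real.rpow_natCast, ← Real.rpow_mul hR0.le, mul_comm, Real.rpow_mul hR0.le,
        Real.rpow_natCast]
    have hquot : 1 + y ^ 2 = ((1 + y ^ 2) / R ^ 2) * R ^ 2 := by field_simp
    rw [hR2, hquot, Real.mul_rpow (by positivity) (by positivity)]
    gcongr
    have hlow : 1 / 4 ≤ (1 + y ^ 2) / R ^ 2 := by
      rw [le_div_iff₀ (by positivity)]; nlinarith
    have hupp : (1 + y ^ 2) / R ^ 2 ≤ 5 := by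
      rw [div_le_iff₀ (by positivity)]; nlinarith
    have hp4 : (0 : ℝ) < (1 / 4) ^ s := by positivity
    have hp5 : (0 : ℝ) < 5 ^ s := by positivity
    rcases le_total 0 s with hs | hs
    · have := Real.rpow_le_rpow (by positivity) hupp hs
      linarith
    · have := Real.rpow_le_rpow_of_nonpos (by norm_num) hlow hs
      linarith
  have hint : ∫⁻ ξ : EuclideanSpace ℝ (Fin n),
      ENNReal.ofReal ((1 + ‖ξ‖ ^ 2) ^ s) * ‖fourierHat f ξ‖ₑ ^ 2 ≤
      (ENNReal.ofReal (√((1 / 4) ^ s + 5 ^ s) * R ^ s) * ‖f‖ₑ) ^ 2 := by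
    rw [mul_pow, ← lintegral_enorm_fourierHat_sq,
      ← lintegral_const_mul' _ _ (ENNReal.pow_ne_top ENNReal.ofReal_ne_top)]
    refine lintegral_mono_ae ?_
    filter_upwards [hf] with ξ hξ
    by_cases h : R / 2 ≤ ‖ξ‖ ∧ ‖ξ‖ ≤ 2 * R
    · gcongr
      rw [← ENNReal.ofReal_pow (by positivity)]
      refine ENNReal.ofReal_le_ofReal ?_
      rw [mul_pow, Real.sq_sqrt (by positivity)]
      exact hweight _ h.1 h.2
    · simp [hξ h]
  calc sobolevNorm s f ≤
      ((ENNReal.ofReal (√((1 / 4) ^ s + 5 ^ s) * R ^ s) * ‖f‖ₑ) ^ 2) ^ (1 / 2 : ℝ) :=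
        ENNReal.rpow_le_rpow hint (by norm_num)
    _ = _ := by
        rw [← ENNReal.rpow_natCast, ← ENNReal.rpow_mul]
        norm_num

/-- The counterexample, with Schwartz data. -/
theorem exists_schwartz_tendsto_maximalL1 (d : ℕ) (hd : 0 < d) {s : ℝ}
    (hs : s < ((d : ℝ) + 1) / (2 * ((d : ℝ) + 2))) :
    ∃ (R : ℕ → ℝ) (f : ℕ → 𝓢(EuclideanSpace ℝ (Fin (d + 1)), ℂ)),
      Tendsto R atTop atTop ∧ (∀ k, 1 ≤ R k) ∧
      (∀ k, ‖((f k).toLp 2 : L2 (d + 1))‖ = 1) ∧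
      (∀ k, ∀ᵐ ξ : EuclideanSpace ℝ (Fin (d + 1)),
        ¬ (R k / 2 ≤ ‖ξ‖ ∧ ‖ξ‖ ≤ 2 * R k) → fourierHat ((f k).toLp 2 : L2 (d + 1)) ξ = 0) ∧
      Tendsto (fun k => ENNReal.ofReal (R k ^ (-s)) * maximalL1 ((f k).toLp 2 : L2 (d + 1)))
        atTop (𝓝 ∞) := by
  obtain ⟨A, c, hA, hc, hU⟩ := exists_coherent_frequencySet d hd
  have hA0 : 0 < A := by linarith
  choose U hUo hUn hUv hUp using fun k : ℕ => hU (k + 1) k.succ_pos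
  have hfk := fun k : ℕ => exists_schwartz_le_maximalL1 (hUo k)
    ((isBounded_iff_forall_norm_le).2 ⟨_, fun ξ hξ => (hUn k ξ hξ).2⟩)
    (by positivity) (hUv k) Set.inter_subset_left (isOpen_ballSlab d).measurableSet (hUp k)
  choose f hf1 hfU hfm using hfk
  have hN : Tendsto (fun k : ℕ => ((k + 1 : ℕ) : ℝ)) atTop atTop :=
    tendsto_natCast_atTop_atTop.comp (tendsto_add_atTop_nat 1)
  have hN1 : ∀ k : ℕ, (1 : ℝ) ≤ ((k + 1 : ℕ) : ℝ) := fun k => by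
    exact_mod_cast Nat.le_add_left 1 k
  have hR1 : ∀ k : ℕ, ((k + 1 : ℕ) : ℝ) ≤ (A * ((k + 1 : ℕ) : ℝ) ^ (d + 2)) ^ 2 := fun k => by
    have h1 : ((k + 1 : ℕ) : ℝ) ≤ ((k + 1 : ℕ) : ℝ) ^ (d + 2) :=
      le_self_pow₀ (hN1 k) (by omega)
    have h2 := hN1 k
    have h3 : ((k + 1 : ℕ) : ℝ) ≤ A * ((k + 1 : ℕ) : ℝ) ^ (d + 2) :=
      h1.trans (le_mul_of_one_le_left (by positivity) hA)
    exact h3.trans (le_self_pow₀ (h2.trans h3) two_ne_zero)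
  refine ⟨fun k => (A * ((k + 1 : ℕ) : ℝ) ^ (d + 2)) ^ 2, f, tendsto_atTop_mono hR1 hN,
    fun k => (hN1 k).trans (hR1 k), hf1, fun k => ?_, ?_⟩
  · filter_upwards [hfU k] with ξ hξ hξ'
    exact hξ fun h => hξ' (hUn k ξ h)
  -- the exponent of `N` in the lower bound `R^{-s} N^{d+1}`
  set e : ℝ := (d + 1) - 2 * (d + 2) * s with he
  have he0 : 0 < e := by
    rw [lt_div_iff₀ (by positivity)] at hs
    linarith
  set C : ℝ := (A ^ 2) ^ (-s) * ((2 * Real.pi) ^ (-((d + 1 : ℕ) : ℝ) / 2) * (1 / 2 * √c)) with hC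
  have hC0 : 0 < C := by positivity
  have hlim : Tendsto (fun k : ℕ => ENNReal.ofReal (C * ((k + 1 : ℕ) : ℝ) ^ e) *
      volume (ballSlab d)) atTop (𝓝 ∞) := by
    have h1 : Tendsto (fun k : ℕ => C * ((k + 1 : ℕ) : ℝ) ^ e) atTop atTop :=
      ((tendsto_rpow_atTop he0).comp hN).const_mul_atTop hC0
    have h2 := ENNReal.Tendsto.mul_const (b := volume (ballSlab d))
      (ENNReal.tendsto_ofReal_atTop.comp h1) (Or.inl ENNReal.top_ne_zero)
    rwa [ENNReal.top_mul (volume_ballSlab_pos d).ne'] at h2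
  refine tendsto_nhds_top_mono' hlim fun k => ?_
  refine le_trans (le_of_eq ?_) (mul_le_mul_right (hfm k) _)
  rw [← mul_assoc, ← ENNReal.ofReal_mul (by positivity)]
  congr 2
  set N : ℝ := ((k + 1 : ℕ) : ℝ) with hNdef
  have hN0 : 0 < N := by linarith [hN1 k]
  have hsq : √(c * N ^ (2 * (d + 1))) = √c * N ^ ((d : ℝ) + 1) := by
    rw [Real.sqrt_mul hc.le, mul_comm 2, pow_mul, Real.sqrt_sq (by positivity),
      ← Real.rpow_natCast]
    push_cast
    rfl
  have hRs : ((A * N ^ (d + 2)) ^ 2) ^ (-s) = (A ^ 2) ^ (-s) * N ^ (-(2 * ((d : ℝ) + 2) * s)) := by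
    rw [mul_pow, Real.mul_rpow (by positivity) (by positivity), ← pow_mul, ← Real.rpow_natCast,
      ← Real.rpow_natCast N, ← Real.rpow_mul hN0.le]
    congr 2
    push_cast
    ring
  have hNe : N ^ e = N ^ (-(2 * ((d : ℝ) + 2) * s)) * N ^ ((d : ℝ) + 1) := by
    rw [← Real.rpow_add hN0, he]
    congr 1
    ring
  rw [hsq, hRs, hNe, hC]
  ring

theorem proposition1 (n : ℕ) (hn : 2 ≤ n) :
    (∀ s : ℝ, s < (n : ℝ) / (2 * ((n : ℝ) + 1)) →
      ∃ (R : ℕ → ℝ) (f : ℕ → L2 n),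
        Tendsto R atTop atTop ∧
        (∀ k, ‖f k‖ = 1) ∧
        (∀ k, ∀ᵐ ξ : EuclideanSpace ℝ (Fin n),
          ¬ (R k / 2 ≤ ‖ξ‖ ∧ ‖ξ‖ ≤ 2 * R k) → fourierHat (f k) ξ = 0) ∧
        Tendsto (fun k => ENNReal.ofReal (R k ^ (-s)) * maximalL1 (f k)) atTop (𝓝 ∞)) ∧
    (∀ s : ℝ, MaximalControlled n s → (n : ℝ) / (2 * ((n : ℝ) + 1)) ≤ s) := by
  obtain ⟨d, rfl⟩ : ∃ d, n = d + 1 := ⟨n - 1, by omega⟩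
  have hd : 0 < d := by omega
  have hexp : ((d + 1 : ℕ) : ℝ) / (2 * (((d + 1 : ℕ) : ℝ) + 1)) =
      ((d : ℝ) + 1) / (2 * ((d : ℝ) + 2)) := by
    push_cast
    ring
  rw [hexp]
  refine ⟨fun s hs => ?_, fun s ⟨C, hC⟩ => ?_⟩
  · obtain ⟨R, f, hR, -, hf, hsupp, hlim⟩ := exists_schwartz_tendsto_maximalL1 d hd hs
    let F : ℕ → L2 (d + 1) := fun k => (f k).toLp 2
    refine ⟨R, F, hR, ?_, ?_, ?_⟩
    · exact hf
    · exact hsupp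
    · exact hlim
  · by_contra! hs
    obtain ⟨R, f, -, hR, hf, hsupp, hlim⟩ := exists_schwartz_tendsto_maximalL1 d hd hs
    set M : ℝ≥0∞ := C * ENNReal.ofReal √((1 / 4) ^ s + 5 ^ s) with hM
    have hbound : ∀ k, ENNReal.ofReal (R k ^ (-s)) *
        maximalL1 ((f k).toLp 2 : L2 (d + 1)) ≤ M := by
      intro k
      have hR0 : 0 < R k := by linarith [hR k]
      have h1 := (hC (f k)).trans (mul_le_mul_right (sobolevNorm_le (hR k) s (hsupp k)) _)
      have h2 : ‖((f k).toLp 2 : L2 (d + 1))‖ₑ = 1 := by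
        rw [← ofReal_norm, hf k, ENNReal.ofReal_one]
      rw [h2, mul_one] at h1
      refine (mul_le_mul_right h1 _).trans_eq ?_
      rw [mul_left_comm, ← ENNReal.ofReal_mul (by positivity), Real.rpow_neg hR0.le, hM]
      congr 2
      field_simp
    have hMtop : M < ∞ := ENNReal.mul_lt_top ENNReal.coe_lt_top ENNReal.ofReal_lt_top
    exact absurd (le_of_tendsto' hlim hbound) (not_le.2 hMtop)
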